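/- **Theorem 3.** Let $\|\cdot\|_{\mathcal X}$, $\|\cdot\|_{\mathcal Z}$ be norms on $\mathbb R^{n_x}$, $\mathbb R^{n_z}$, let $[\![\cdot;\cdot]\!]$ be a weak pairing on $\mathbb R^{n_x}$ compatible with $\|\cdot\|_{\mathcal X}$ (that is, subadditive and continuous in its first argument, $[\![\alpha x;y]\!]=[\![x;\alpha y]\!]=\alpha[\![x;y]\!]$ for $\alpha\ge 0$, $[\![-x;-y]\!]=[\![x;y]\!]$, $[\![x;x]\!]=\|x\|_{\mathcal X}^2$, $|[\![x;y]\!]|\le\|x\|_{\mathcal X}\|y\|_{\mathcal X}$), and let $\mathcal X\subseteq\mathbb R^{n_x}$, $\mathcal Z\subseteq\mathbb R^{n_z}$ be convex sets containing the origin, $\mathcal Z$ closed. Let $f:\mathcal X\times\mathcal Z\to\mathbb R^{n_x}$ and $\mathsf G:\mathcal X\times\mathcal Z\to\mathcal Z$ be continuous with $f(0,0)=0$, $\mathsf G(0,0)=0$. For $n\in\mathbb Z_{>0}$ and $T>0$ consider the sampled-data system $$\dot x(t)=f(x(t),z(t)),\qquad z(t)=z_k\ \text{ for } t\in[kT,(k+1)T),\qquad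 z_k=\mathsf G^n(x(kT),z_{k-1}),$$ where $\mathsf G^n(x,\cdot)$ is the $n$-fold composition of $z\mapsto\mathsf G(x,z)$, and the initial state $(x(0),z(0))=(x(0),z_0)\in\mathcal X\times\mathcal Z$ is arbitrary. Suppose that $\mathcal X$ and $\mathcal Z$ are forward invariant: for each constant $z\in\mathcal Z$ and each $x_0\in\mathcal X$ the equation $\dot x=f(x,z)$, $x(0)=x_0$, has a solution in $\mathcal X$ on $[0,\infty)$. Let $\mathsf{Lip}_x,\mathsf{Lip}_z$ denote minimal Lipschitz constants in one variable, uniform over the other one, on $\mathcal X\times\mathcal Z$. Likewise let $\mathsf{osLip}(F)=\sup_{x_1\ne x_2\in\mathcal X}[\![F(x_1)-F(x_2);x_1-x_2]\!]/\|x_1-x_2\|_{\mathcal X}^2$ and $\mathsf{osLip}_x(f)=\sup_{z\in\mathcal Z}\mathsf{osLip}(f(\cdot,z))$. Assume 1. $\mathsf{Lip}_x(f)<\infty$; 2. $0<\mathsf{Lip}_z(f)<\infty$ and $0<\mathsf{Lip}_x(\mathsf G)<\infty$; 3. $\mathsf{Lip}_z(\mathsf G)<1$. Let $z^*(x)\in\mathcal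 Z$ be the unique solution of $z^*(x)=\mathsf G(x,z^*(x))$. Let $\xi\in\mathbb R$ satisfy $\xi\ge\mathsf{osLip}_x(f)$, and suppose that the reduced model $\dot x=f(x,z^*(x))$ is strongly infinitesimally contracting: $\mathsf{osLip}(f(\cdot,z^*(\cdot)))\le-\zeta$ for some $\zeta>0$. Put $$C_1=\frac{\mathsf{Lip}_z(f)\mathsf{Lip}_x(\mathsf G)}{1-\mathsf{Lip}_z(\mathsf G)}\Bigl(\mathsf{Lip}_x(f)+\frac{\mathsf{Lip}_z(f)\mathsf{Lip}_x(\mathsf G)}{1-\mathsf{Lip}_z(\mathsf G)}\Bigr),\quad C_2(n)=[\mathsf{Lip}_z(\mathsf G)]^n\,\frac{\mathsf{Lip}_x(\mathsf G)\mathsf{Lip}_z(f)}{1-\mathsf{Lip}_z(\mathsf G)},\quad q_n=\frac{1-[\mathsf{Lip}_z(\mathsf G)]^n}{C_2(n)+C_1/\zeta},$$ $$T(n)=\begin{cases}\frac1\xi\log(\xi q_n+1)&\text{if }\xi\ne0,\ \xi q_n+1>0,\\ q_n&\text{if }\xi=0,\\ +\infty&\text{if }\xi q_n+1\le0.\end{cases}$$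 Then, for every $n\in\mathbb Z_{>0}$, $T(n)>0$, and for every $T$ with $0<T<T(n)$ the sampled-data system renders the origin globally exponentially stable: a solution in $\mathcal X\times\mathcal Z$ on $[0,\infty)$ exists from every initial state in $\mathcal X\times\mathcal Z$, and for every norm $\|\cdot\|$ on $\mathbb R^{n_x}\times\mathbb R^{n_z}$ there are $a>0$ and $r\ge0$ such that every solution $y=(x,z)$ satisfies $\|y(t)\|\le r\,e^{-at}\|y(0)\|$ for all $t\ge0$. -/

import Mathlib

open Set
open scoped ENNReal

/-- A weak pairing on a real topological vector space. -/
structure WeakPairing (E : Type*) [AddCommGroup E] [Module ℝ E] [TopologicalSpace E] where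
  /-- the value of the pairing, `pair x y` being written `⟦x ; y⟧` on paper -/
  pair : E → E → ℝ
  pair_add_le : ∀ x₁ x₂ y, pair (x₁ + x₂) y ≤ pair x₁ y + pair x₂ y
  continuous_fst : ∀ y, Continuous fun x => pair x y
  smul_left : ∀ (a : ℝ) (x y : E), 0 ≤ a → pair (a • x) y = a * pair x y
  smul_right : ∀ (a : ℝ) (x y : E), 0 ≤ a → pair x (a • y) = a * pair x y
  neg_neg : ∀ x y, pair (-x) (-y) = pair x y
  pos_def : ∀ x, x ≠ 0 → 0 < pair x x
  cauchy_schwarz : ∀ x y, |pair x y| ≤ Real.sqrt (pair x x) * Real.sqrt (pair y y)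

/-- The weak pairing induces the norm: `⟦x ; x⟧ = ‖x‖²`. -/
def WeakPairing.Compatible {E : Type*} [NormedAddCommGroup E] [NormedSpace ℝ E]
    (P : WeakPairing E) : Prop :=
  ∀ x : E, P.pair x x = ‖x‖ ^ 2

section Constants

variable {E F H : Type*} [NormedAddCommGroup E] [NormedAddCommGroup F] [NormedAddCommGroup H]

/-- Minimal Lipschitz constant of `x ↦ φ x z` on `X`, uniformly over `z ∈ Z`
(it is `⊤` if there is none). -/
noncomputable def lipFst (X : Set E) (Z : Set F) (φ : E → F → H) : ℝ≥0∞ :=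
  ⨆ z ∈ Z, ⨆ x₁ ∈ X, ⨆ x₂ ∈ X, ⨆ _ : x₁ ≠ x₂,
    ENNReal.ofReal (‖φ x₁ z - φ x₂ z‖ / ‖x₁ - x₂‖)

/-- Minimal Lipschitz constant of `z ↦ φ x z` on `Z`, uniformly over `x ∈ X`
(it is `⊤` if there is none). -/
noncomputable def lipSnd (X : Set E) (Z : Set F) (φ : E → F → H) : ℝ≥0∞ :=
  ⨆ x ∈ X, ⨆ z₁ ∈ Z, ⨆ z₂ ∈ Z, ⨆ _ : z₁ ≠ z₂,
    ENNReal.ofReal (‖φ x z₁ - φ x z₂‖ / ‖z₁ - z₂‖)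

/-- Minimal one-sided Lipschitz constant on `X` of a vector field `φ`. -/
noncomputable def osLip [NormedSpace ℝ E] (P : WeakPairing E) (X : Set E) (φ : E → E) : EReal :=
  ⨆ x₁ ∈ X, ⨆ x₂ ∈ X, ⨆ _ : x₁ ≠ x₂,
    ((P.pair (φ x₁ - φ x₂) (x₁ - x₂) / ‖x₁ - x₂‖ ^ 2 : ℝ) : EReal)

/-- Minimal one-sided Lipschitz constant of `x ↦ φ x z` on `X`, uniformly over `z ∈ Z`. -/
noncomputable def osLipFst [NormedSpace ℝ E] (P : WeakPairing E) (X : Set E) (Z : Set F)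
    (φ : E → F → E) : EReal :=
  ⨆ z ∈ Z, osLip P X fun x => φ x z

end Constants

/-- `zStar Z G x` is the fixed point in `Z` of `z ↦ G x z`. (It exists and is unique if `Z` is
closed and nonempty and `G x` is a contraction of `Z`; otherwise the value may be arbitrary.) -/
noncomputable def zStar {E F : Type*} [Nonempty F] (Z : Set F) (G : E → F → F) (x : E) : F :=
  Classical.epsilon fun z => z ∈ Z ∧ G x z = z

section System

variable {E F : Type*} [NormedAddCommGroup E] [NormedSpace ℝ E]
  [NormedAddCommGroup F] [NormedSpace ℝ F]

/-- `x` solves `ẋ = f(x, u)` on `[0, ∞)` with input signal `u`, without leaving `X`. The equation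
is asked for with the derivative from the right at every time; at the times where `u` is locally
constant and `f` is continuous this is the usual derivative. -/
structure SolvesODE (f : E → F → E) (X : Set E) (u : ℝ → F) (x : ℝ → E) : Prop where
  continuousOn : ContinuousOn x (Ici 0)
  mem : ∀ t, 0 ≤ t → x t ∈ X
  deriv : ∀ t, 0 ≤ t → HasDerivWithinAt x (f (x t) (u t)) (Ici t) t

/-- `X` and `Z` are forward invariant for the plant `ẋ = f(x, z)`, `z ∈ Z` held constant, and for
the updates `z ↦ G(x, z)`, `x ∈ X`. (`f` and `G` are meaningful on `X × Z` only.) -/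
structure ForwardInvariant (f : E → F → E) (G : E → F → F) (X : Set E) (Z : Set F) : Prop where
  plant : ∀ z ∈ Z, ∀ x₀ ∈ X, ∃ x : ℝ → E, x 0 = x₀ ∧ SolvesODE f X (fun _ => z) x
  update : ∀ x ∈ X, ∀ z ∈ Z, G x z ∈ Z

/-- `t ↦ (x t, z t)` is a solution in `X × Z` of the sampled-data system with `n` iterations and
sampling period `T`:
`ẋ(t) = f(x(t), z(t))`, `z(t) = z_k` for `t ∈ [kT, (k+1)T)`, `z_{k+1} = Gⁿ(x((k+1)T), z_k)`,
where `z_k = z(kT)` and `z_0` is an arbitrary initial value. -/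
structure IsSolution (f : E → F → E) (G : E → F → F) (X : Set E) (Z : Set F) (n : ℕ) (T : ℝ)
    (x : ℝ → E) (z : ℝ → F) : Prop where
  plant : SolvesODE f X z x
  mem : ∀ t, 0 ≤ t → z t ∈ Z
  hold : ∀ k : ℕ, ∀ t ∈ Ico ((k : ℝ) * T) (((k : ℝ) + 1) * T), z t = z ((k : ℝ) * T)
  update : ∀ k : ℕ,
    z (((k : ℝ) + 1) * T) = (G (x (((k : ℝ) + 1) * T)))^[n] (z ((k : ℝ) * T))

/-- The sampled-data system renders the origin globally exponentially stable: from every initial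
state in `X × Z` there is a solution for all times, and for every norm `N` on the product space
all solutions `y = (x, z)` satisfy `N (y t) ≤ r e^{-at} N (y 0)`, with `a`, `r` independent of the
solution. -/
def RendersOriginGES (f : E → F → E) (G : E → F → F) (X : Set E) (Z : Set F) (n : ℕ) (T : ℝ) :
    Prop :=
  (∀ x₀ ∈ X, ∀ z₀ ∈ Z, ∃ (x : ℝ → E) (z : ℝ → F),
    x 0 = x₀ ∧ z 0 = z₀ ∧ IsSolution f G X Z n T x z) ∧
  ∀ N : Seminorm ℝ (E × F), (∀ v, N v = 0 → v = 0) →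
    ∃ a : ℝ, 0 < a ∧ ∃ r : ℝ, 0 ≤ r ∧
      ∀ (x : ℝ → E) (z : ℝ → F), IsSolution f G X Z n T x z →
        ∀ t, 0 ≤ t → N (x t, z t) ≤ r * Real.exp (-a * t) * N (x 0, z 0)

end System

/-- `C₁`, from `Lip_x(f)`, `Lip_z(f)`, `Lip_x(G)`, `Lip_z(G)`. -/
noncomputable def gainC₁ (Lxf Lzf LxG LzG : ℝ) : ℝ :=
  Lzf * LxG / (1 - LzG) * (Lxf + Lzf * LxG / (1 - LzG))

/-- `C₂(n)`, from `Lip_z(f)`, `Lip_x(G)`, `Lip_z(G)`. -/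
noncomputable def gainC₂ (Lzf LxG LzG : ℝ) (n : ℕ) : ℝ :=
  LzG ^ n * (LxG * Lzf / (1 - LzG))

/-- The threshold `T(n)` on the sampling period, from `ξ`, `ζ` and `Lip_x(f)`, `Lip_z(f)`,
`Lip_x(G)`, `Lip_z(G)`. With `q = (1 - Lip_z(G)ⁿ) / (C₂(n) + C₁/ζ)` it is the supremum of the `T`
with `∫₀ᵀ e^{ξ(T-s)} ds < q`: it is `q` if `ξ = 0`, it is `(1/ξ) log (ξ q + 1)` if `ξ ≠ 0` and
`ξ q + 1 > 0`, and there is no restriction (`T(n) = ∞`) if `ξ q + 1 ≤ 0`. -/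
noncomputable def samplingThreshold (ξ ζ Lxf Lzf LxG LzG : ℝ) (n : ℕ) : EReal :=
  if ξ = 0 then
    (((1 - LzG ^ n) / (gainC₂ Lzf LxG LzG n + gainC₁ Lxf Lzf LxG LzG / ζ) : ℝ) : EReal)
  else if 0 < ξ * (1 - LzG ^ n) / (gainC₂ Lzf LxG LzG n + gainC₁ Lxf Lzf LxG LzG / ζ) + 1 then
    ((1 / ξ * Real.log
      (ξ * (1 - LzG ^ n) / (gainC₂ Lzf LxG LzG n + gainC₁ Lxf Lzf LxG LzG / ζ) + 1) : ℝ) : EReal)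
  else ⊤

/-! Write κ = Lip_z(f) Lip_x(G) / (1 - Lip_z(G)) and φ = ∫₀ᵀ e^{ξs} ds, which is `gronwallBound 0 ξ
1 T`. During one period with held input w, the plant is the reduced model perturbed by f(x, w) -
f(x, z*(x)), of norm at most Lip_z(f) ‖w - z*(x)‖. The state moves by at most φ ‖f(x(kT), w)‖ and z*
is Lipschitz, so the perturbation stays below a number V_k that is linear in ‖w - z*(x)‖ and ‖x‖ at
time kT (`mismatch_le`).

Contraction of the reduced model gives ‖x_{k+1}‖ ≤ e^{-ζT} ‖x_k‖ + (1 - e^{-ζT}) V_k / ζ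
(`norm_le_of_held`). The n iterations shrink the mismatch by Lip_z(G)ⁿ, hence V_{k+1} ≤ A V_k + B
‖x_{k+1}‖ with A = (1 + κφ) Lip_z(G)ⁿ and B = C₁ φ. Such a pair decays geometrically once A + B/ζ <
1 (`exists_weights`, `geometric_decay`), and since A + B/ζ = Lip_z(G)ⁿ + φ (C₂(n) + C₁/ζ), this says
φ < q_n, which T < T(n) ensures.

Both differential estimates rest on `norm_le_gronwallBound`, where the weak pairing controls the
growth of the norm along a curve. -/

section Auxiliary

open Filter Topology

/-! ### Pointwise bounds from the minimal Lipschitz constants -/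

section Constants

variable {E F H : Type*} [NormedAddCommGroup H]

lemma norm_sub_le_lipFst [NormedAddCommGroup E] {X : Set E} {Z : Set F} {φ : E → F → H} (h : lipFst X Z φ < ⊤)
    {z : F} (hz : z ∈ Z) {x₁ x₂ : E} (h₁ : x₁ ∈ X) (h₂ : x₂ ∈ X) :
    ‖φ x₁ z - φ x₂ z‖ ≤ (lipFst X Z φ).toReal * ‖x₁ - x₂‖ := by
  rcases eq_or_ne x₁ x₂ with rfl | hne
  · simp
  have hpos : 0 < ‖x₁ - x₂‖ := norm_pos_iff.2 (sub_ne_zero.2 hne)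
  rw [← div_le_iff₀ hpos, ← ENNReal.ofReal_le_iff_le_toReal h.ne]
  exact le_iSup₂_of_le z hz <| le_iSup₂_of_le x₁ h₁ <| le_iSup₂_of_le x₂ h₂ <|
    le_iSup_of_le hne le_rfl

lemma norm_sub_le_lipSnd [NormedAddCommGroup F] {X : Set E} {Z : Set F} {φ : E → F → H} (h : lipSnd X Z φ < ⊤)
    {x : E} (hx : x ∈ X) {z₁ z₂ : F} (h₁ : z₁ ∈ Z) (h₂ : z₂ ∈ Z) :
    ‖φ x z₁ - φ x z₂‖ ≤ (lipSnd X Z φ).toReal * ‖z₁ - z₂‖ := by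
  rcases eq_or_ne z₁ z₂ with rfl | hne
  · simp
  have hpos : 0 < ‖z₁ - z₂‖ := norm_pos_iff.2 (sub_ne_zero.2 hne)
  rw [← div_le_iff₀ hpos, ← ENNReal.ofReal_le_iff_le_toReal h.ne]
  exact le_iSup₂_of_le x hx <| le_iSup₂_of_le z₁ h₁ <| le_iSup₂_of_le z₂ h₂ <|
    le_iSup_of_le hne le_rfl

end Constants

/-! ### Weak pairings and growth of the norm along curves -/

namespace WeakPairing

variable {E : Type*} [NormedAddCommGroup E] [NormedSpace ℝ E] {P : WeakPairing E}

lemma Compatible.pair_le (hP : P.Compatible) (x y : E) : P.pair x y ≤ ‖x‖ * ‖y‖ := by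
  have h := P.cauchy_schwarz x y
  rw [hP x, hP y, Real.sqrt_sq (norm_nonneg x), Real.sqrt_sq (norm_nonneg y)] at h
  exact (le_abs_self _).trans h

/-- Subadditivity for x = (x - y) + y, then Cauchy–Schwarz. It replaces the derivative of ‖·‖²/2,
which need not exist. -/
lemma Compatible.norm_mul_sub_le (hP : P.Compatible) (x y : E) :
    ‖x‖ * (‖x‖ - ‖y‖) ≤ P.pair (x - y) x := by
  have h₁ := P.pair_add_le (x - y) y x
  rw [sub_add_cancel, hP x] at h₁
  nlinarith [hP.pair_le y x]

lemma Compatible.pair_le_of_osLip_le (hP : P.Compatible) {X : Set E} {φ : E → E} {c : ℝ}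
    (h : osLip P X φ ≤ (c : EReal)) {x₁ x₂ : E} (h₁ : x₁ ∈ X) (h₂ : x₂ ∈ X) :
    P.pair (φ x₁ - φ x₂) (x₁ - x₂) ≤ c * ‖x₁ - x₂‖ ^ 2 := by
  rcases eq_or_ne x₁ x₂ with rfl | hne
  · simpa using hP.pair_le (0 : E) 0
  have hpos : 0 < ‖x₁ - x₂‖ ^ 2 := by
    have := norm_pos_iff.2 (sub_ne_zero.2 hne)
    positivity
  rw [← div_le_iff₀ hpos, ← EReal.coe_le_coe_iff]
  refine le_trans ?_ h
  exact le_iSup₂_of_le x₁ h₁ <| le_iSup₂_of_le x₂ h₂ <| le_iSup_of_le hne le_rfl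

/-- An upper bound of the right Dini derivative of the norm along a curve, by the weak pairing. -/
lemma Compatible.eventually_slope_norm_lt (hP : P.Compatible) {g y : ℝ → E} {s c ξ r : ℝ}
    (hc : 0 ≤ c) (hg : HasDerivWithinAt g (y s) (Ici s) s)
    (hy : ContinuousWithinAt y (Ioi s) s)
    (hpair : ∀ᶠ t in 𝓝[>] s, P.pair (y t) (g t) ≤ ξ * ‖g t‖ ^ 2 + c * ‖g t‖)
    (hr : ξ * ‖g s‖ + c < r) :
    ∀ᶠ t in 𝓝[>] s, (t - s)⁻¹ * (‖g t‖ - ‖g s‖) < r := by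
  have hslope : Tendsto (slope g s) (𝓝[>] s) (𝓝 (y s)) :=
    (hasDerivWithinAt_iff_tendsto_slope' self_notMem_Ioi).1 (hg.mono Ioi_subset_Ici_self)
  have hgc : Tendsto g (𝓝[>] s) (𝓝 (g s)) :=
    (hg.continuousWithinAt.mono Ioi_subset_Ici_self)
  have hlim : Tendsto (fun t => ξ * ‖g t‖ + c + ‖slope g s t - y t‖) (𝓝[>] s)
      (𝓝 (ξ * ‖g s‖ + c + ‖y s - y s‖)) :=
    ((hgc.norm.const_mul ξ).add_const c).add (hslope.sub hy).norm
  rw [sub_self, norm_zero, add_zero] at hlim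
  filter_upwards [hpair, hlim.eventually_lt_const hr, self_mem_nhdsWithin] with t ht hlt hst
  refine lt_of_le_of_lt ?_ hlt
  have hh : 0 < t - s := sub_pos.2 hst
  rw [inv_mul_le_iff₀ hh]
  -- The pairing estimates carry a factor ‖g t‖, which can be cancelled only if it is nonzero.
  rcases eq_or_ne (g t) 0 with h0 | h0
  · rw [h0, norm_zero]
    have : 0 ≤ (t - s) * (ξ * 0 + c + ‖slope g s t - y t‖) := by
      rw [mul_zero, zero_add]; positivity
    linarith [norm_nonneg (g s)]
  have hpos : 0 < ‖g t‖ := norm_pos_iff.2 h0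
  have e : g t - g s = (t - s) • slope g s t := by
    rw [slope_def_module, smul_smul, mul_inv_cancel₀ hh.ne', one_smul]
  -- Pairing with the later point `g t` avoids any continuity in the second argument; replacing the
  -- slope by `y t` costs ‖slope - y t‖, which tends to 0.
  have h₁ := hP.norm_mul_sub_le (g t) (g s)
  rw [e, P.smul_left _ _ _ hh.le] at h₁
  have h₂ := P.pair_add_le (slope g s t - y t) (y t) (g t)
  rw [sub_add_cancel] at h₂
  have h₃ := hP.pair_le (slope g s t - y t) (g t)
  refine le_of_mul_le_mul_left ?_ hpos
  calc ‖g t‖ * (‖g t‖ - ‖g s‖) ≤ (t - s) * P.pair (slope g s t) (g t) := h₁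
    _ ≤ (t - s) * (‖slope g s t - y t‖ * ‖g t‖ + (ξ * ‖g t‖ ^ 2 + c * ‖g t‖)) := by
        gcongr; linarith
    _ = ‖g t‖ * ((t - s) * (ξ * ‖g t‖ + c + ‖slope g s t - y t‖)) := by ring

lemma Compatible.norm_le_gronwallBound (hP : P.Compatible) {g y : ℝ → E} {a b c ξ : ℝ}
    (hc : 0 ≤ c) (hg : ContinuousOn g (Icc a b))
    (hg' : ∀ t ∈ Ico a b, HasDerivWithinAt g (y t) (Ici t) t)
    (hy : ∀ t ∈ Ico a b, ContinuousWithinAt y (Ioi t) t)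
    (hpair : ∀ t ∈ Ico a b, P.pair (y t) (g t) ≤ ξ * ‖g t‖ ^ 2 + c * ‖g t‖)
    {t : ℝ} (ht : t ∈ Icc a b) : ‖g t‖ ≤ gronwallBound ‖g a‖ ξ c (t - a) := by
  refine le_gronwallBound_of_liminf_deriv_right_le (f := fun t => ‖g t‖)
    (f' := fun t => ξ * ‖g t‖ + c) hg.norm (fun s hs r hr => ?_) le_rfl (fun _ _ => le_rfl) t ht
  refine (hP.eventually_slope_norm_lt hc (hg' s hs) (hy s hs) ?_ hr).frequently
  filter_upwards [Ioo_mem_nhdsGT hs.2] with t ht using hpair t ⟨hs.1.trans ht.1.le, ht.2⟩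

end WeakPairing

/-! ### The comparison function ∫₀ᵗ e^{Ks} ds and the sampling threshold -/

section Gronwall

lemma gronwallBound_zero_mul (K ε t : ℝ) :
    gronwallBound 0 K ε t = ε * gronwallBound 0 K 1 t := by
  unfold gronwallBound
  split_ifs <;> ring

lemma gronwallBound_zero_one_strictMono (K : ℝ) : StrictMono (gronwallBound 0 K 1) := by
  intro s t hst
  unfold gronwallBound
  split_ifs with hK
  · linarith
  · rcases lt_or_gt_of_ne hK with h | h
    · have : Real.exp (K * t) < Real.exp (K * s) :=
        Real.exp_lt_exp.2 (mul_lt_mul_of_neg_left hst h)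
      have h2 : 1 / K < 0 := one_div_neg.2 h
      nlinarith
    · have : Real.exp (K * s) < Real.exp (K * t) :=
        Real.exp_lt_exp.2 (mul_lt_mul_of_pos_left hst h)
      have h2 : 0 < 1 / K := one_div_pos.2 h
      nlinarith

lemma gronwallBound_zero_one_pos (K : ℝ) {t : ℝ} (ht : 0 < t) : 0 < gronwallBound 0 K 1 t := by
  simpa [gronwallBound_x0] using gronwallBound_zero_one_strictMono K ht

end Gronwall

section Threshold

variable {ξ ζ Lxf Lzf LxG LzG T : ℝ} {n : ℕ}

lemma samplingThreshold_pos
    (hq : 0 < (1 - LzG ^ n) / (gainC₂ Lzf LxG LzG n + gainC₁ Lxf Lzf LxG LzG / ζ)) :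
    0 < samplingThreshold ξ ζ Lxf Lzf LxG LzG n := by
  unfold samplingThreshold
  rw [mul_div_assoc]
  set q := (1 - LzG ^ n) / (gainC₂ Lzf LxG LzG n + gainC₁ Lxf Lzf LxG LzG / ζ)
  split_ifs with h0 h1
  · exact_mod_cast hq
  · rw [EReal.coe_pos]
    rcases lt_or_gt_of_ne h0 with h | h
    · exact mul_pos_of_neg_of_neg (one_div_neg.2 h) (Real.log_neg h1 (by nlinarith))
    · exact mul_pos (one_div_pos.2 h) (Real.log_pos (by nlinarith [mul_pos h hq]))
  · simp

lemma gronwallBound_lt_of_lt_samplingThreshold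
    (hq : 0 < (1 - LzG ^ n) / (gainC₂ Lzf LxG LzG n + gainC₁ Lxf Lzf LxG LzG / ζ))
    (hT : (T : EReal) < samplingThreshold ξ ζ Lxf Lzf LxG LzG n) :
    gronwallBound 0 ξ 1 T <
      (1 - LzG ^ n) / (gainC₂ Lzf LxG LzG n + gainC₁ Lxf Lzf LxG LzG / ζ) := by
  unfold samplingThreshold at hT
  rw [mul_div_assoc] at hT
  set q := (1 - LzG ^ n) / (gainC₂ Lzf LxG LzG n + gainC₁ Lxf Lzf LxG LzG / ζ)
  unfold gronwallBound
  split_ifs at hT ⊢ with h0 h1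
  · have := EReal.coe_lt_coe_iff.1 hT
    linarith
  · have hT := EReal.coe_lt_coe_iff.1 hT
    rw [zero_mul, zero_add, one_div_mul_eq_div]
    rw [one_div_mul_eq_div] at hT
    rcases lt_or_gt_of_ne h0 with h | h
    · rw [lt_div_iff_of_neg h, mul_comm T, Real.log_lt_iff_lt_exp h1] at hT
      rw [div_lt_iff_of_neg h]
      linarith
    · rw [lt_div_iff₀ h, mul_comm T, Real.lt_log_iff_exp_lt h1] at hT
      rw [div_lt_iff₀ h]
      linarith
  -- With ξ q + 1 ≤ 0 every T is admissible: the integral stays below its limit -1/ξ, which is at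
  -- most q.
  · have h : ξ < 0 := by
      by_contra hc
      nlinarith [mul_nonneg (not_lt.1 hc) hq.le]
    rw [zero_mul, zero_add, one_div_mul_eq_div, div_lt_iff_of_neg h]
    linarith [Real.exp_pos (ξ * T)]

end Threshold

/-! ### Fixed points of the iteration -/

section FixedPoint

variable {E F : Type*} [NormedAddCommGroup F] [CompleteSpace F]

lemma zStar_spec {X : Set E} {Z : Set F} (hZc : IsClosed Z) (hZn : Z.Nonempty) {G : E → F → F}
    (hLzG : lipSnd X Z G < 1) {x : E} (hx : x ∈ X) (hG : ∀ z ∈ Z, G x z ∈ Z) :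
    zStar Z G x ∈ Z ∧ G x (zStar Z G x) = zStar Z G x := by
  refine Classical.epsilon_spec (p := fun z => z ∈ Z ∧ G x z = z) ?_
  obtain ⟨z₀, hz₀⟩ := hZn
  have hfin : lipSnd X Z G < ⊤ := hLzG.trans ENNReal.one_lt_top
  have hmaps : MapsTo (G x) Z Z := hG
  have hcontr : ContractingWith (lipSnd X Z G).toNNReal (hmaps.restrict (G x) Z Z) := by
    refine ⟨?_, LipschitzWith.of_dist_le_mul fun u v => ?_⟩
    · rw [← ENNReal.toNNReal_one]
      exact (ENNReal.toNNReal_lt_toNNReal hfin.ne ENNReal.one_ne_top).2 hLzG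
    · rw [Subtype.dist_eq, Subtype.dist_eq, dist_eq_norm, dist_eq_norm]
      exact norm_sub_le_lipSnd hfin hx u.2 v.2
  obtain ⟨z, hz, hfix, -⟩ :=
    ContractingWith.exists_fixedPoint' hZc.isComplete hmaps hcontr hz₀ (edist_ne_top _ _)
  exact ⟨z, hz, hfix⟩

end FixedPoint

/-! ### Equivalence of norms in finite dimension -/

section Seminorm

variable {V : Type*} [NormedAddCommGroup V] [NormedSpace ℝ V] [FiniteDimensional ℝ V]

lemma Seminorm.continuous_of_finiteDimensional (N : Seminorm ℝ V) : Continuous N := by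
  have := N.convexOn.continuousOn isOpen_univ
  exact continuousOn_univ.1 this

lemma Seminorm.exists_norm_equiv (N : Seminorm ℝ V) (hN : ∀ v, N v = 0 → v = 0) :
    ∃ c C : ℝ, 0 ≤ c ∧ 0 ≤ C ∧ ∀ v, N v ≤ C * ‖v‖ ∧ ‖v‖ ≤ c * N v := by
  have hc := N.continuous_of_finiteDimensional
  obtain ⟨C, hC, hCb⟩ := Seminorm.bound_of_continuous_normedSpace N hc
  have : ∃ m : ℝ, 0 < m ∧ ∀ v ∈ Metric.sphere (0 : V) 1, m ≤ N v := by
    -- The sphere is empty when V is trivial; any positive m then serves.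
    rcases (Metric.sphere (0 : V) 1).eq_empty_or_nonempty with h | h
    · exact ⟨1, one_pos, by simp [h]⟩
    · obtain ⟨v₀, hv₀, hmin⟩ := (isCompact_sphere (0 : V) 1).exists_isMinOn h hc.continuousOn
      refine ⟨N v₀, (apply_nonneg N v₀).lt_of_ne fun h0 => ?_, fun v hv => hmin hv⟩
      simp [hN v₀ h0.symm] at hv₀
  obtain ⟨m, hm, hmb⟩ := this
  refine ⟨m⁻¹, C, by positivity, hC.le, fun v => ⟨hCb v, ?_⟩⟩
  rcases eq_or_ne v 0 with rfl | hv
  · simp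
  have hpos := norm_pos_iff.2 hv
  have h := hmb (‖v‖⁻¹ • v) (by simp [norm_smul, hpos.ne'])
  rw [map_smul_eq_mul, norm_inv, norm_norm, le_inv_mul_iff₀ hpos] at h
  rw [le_inv_mul_iff₀ hm]
  linarith

end Seminorm

variable {E F : Type*} [NormedAddCommGroup E] [NormedSpace ℝ E]
  [NormedAddCommGroup F] [NormedSpace ℝ F]

/-! ### Existence of solutions -/

section Existence

omit [NormedAddCommGroup F] [NormedSpace ℝ F] in
/-- Solutions of the plant over the successive sampling periods are concatenated. -/
lemma exists_isSolution {f : E → F → E} {G : E → F → F} {X : Set E} {Z : Set F}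
    (hinv : ForwardInvariant f G X Z) (n : ℕ) {T : ℝ} (hT : 0 < T) {x₀ : E} (hx₀ : x₀ ∈ X)
    {z₀ : F} (hz₀ : z₀ ∈ Z) :
    ∃ (x : ℝ → E) (z : ℝ → F), x 0 = x₀ ∧ z 0 = z₀ ∧ IsSolution f G X Z n T x z := by
  choose! ψ hψ0 hψ using hinv.plant
  have hG : ∀ x ∈ X, ∀ z ∈ Z, (G x)^[n] z ∈ Z := fun x hx z hz =>
    MapsTo.iterate (f := G x) (s := Z) (hinv.update x hx) n hz
  let step : E × F → E × F := fun p => (ψ p.2 p.1 T, (G (ψ p.2 p.1 T))^[n] p.2)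
  let s : ℕ → E × F := fun k => step^[k] (x₀, z₀)
  have hs1 : ∀ k, s (k + 1) = step (s k) := fun k => Function.iterate_succ_apply' step k _
  have hs : ∀ k, (s k).1 ∈ X ∧ (s k).2 ∈ Z := by
    intro k
    induction k with
    | zero => exact ⟨hx₀, hz₀⟩
    | succ k ih =>
      rw [hs1]
      have := (hψ _ ih.2 _ ih.1).mem T hT.le
      exact ⟨this, hG _ this _ ih.2⟩
  let N : ℝ → ℕ := fun t => ⌊t / T⌋₊
  let x : ℝ → E := fun t => ψ (s (N t)).2 (s (N t)).1 (t - N t * T)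
  let z : ℝ → F := fun t => (s (N t)).2
  have hN : ∀ k : ℕ, ∀ t ∈ Ico ((k : ℝ) * T) (((k : ℝ) + 1) * T), N t = k := by
    intro k t ht
    have h1 : (k : ℝ) ≤ t / T := (le_div_iff₀ hT).2 ht.1
    exact (Nat.floor_eq_iff ((Nat.cast_nonneg k).trans h1)).2 ⟨h1, (div_lt_iff₀ hT).2 ht.2⟩
  have hIco : ∀ t, 0 ≤ t → t ∈ Ico ((N t : ℝ) * T) (((N t : ℝ) + 1) * T) := by
    intro t ht
    exact ⟨(le_div_iff₀ hT).1 (Nat.floor_le (by positivity)),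
      (div_lt_iff₀ hT).1 (Nat.lt_floor_add_one _)⟩
  have hmem : ∀ k : ℕ, (k : ℝ) * T ∈ Ico ((k : ℝ) * T) (((k : ℝ) + 1) * T) := fun k =>
    ⟨le_rfl, by nlinarith⟩
  have hsol := fun k => hψ _ (hs k).2 _ (hs k).1
  have hxk : ∀ k : ℕ, ∀ t ∈ Ico ((k : ℝ) * T) (((k : ℝ) + 1) * T),
      x t = ψ (s k).2 (s k).1 (t - k * T) := by
    intro k t ht
    simp only [x, hN k t ht]
  have hzk : ∀ k : ℕ, ∀ t ∈ Ico ((k : ℝ) * T) (((k : ℝ) + 1) * T), z t = (s k).2 := by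
    intro k t ht
    simp only [z, hN k t ht]
  have hxs : ∀ k : ℕ, x (k * T) = (s k).1 := by
    intro k
    rw [hxk k _ (hmem k), sub_self, hψ0 _ (hs k).2 _ (hs k).1]
  -- The k-th formula also holds at the right endpoint, since the next piece starts where this one
  -- ends; this is what makes `x` continuous.
  have hxIcc : ∀ k : ℕ, ∀ t ∈ Icc ((k : ℝ) * T) (((k : ℝ) + 1) * T),
      x t = ψ (s k).2 (s k).1 (t - k * T) := by
    intro k t ht
    rcases ht.2.lt_or_eq with h | h
    · exact hxk k t ⟨ht.1, h⟩
    · have h2 := hxs (k + 1)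
      rw [hs1] at h2
      push_cast at h2
      rw [h, h2]
      simp only [step]
      congr 1
      ring
  have hderiv : ∀ t, 0 ≤ t → HasDerivWithinAt x (f (x t) (z t)) (Ici t) t := by
    intro t ht
    have hI := hIco t ht
    have h := (hsol (N t)).deriv (t - N t * T) (sub_nonneg.2 hI.1)
    have h2 := HasDerivWithinAt.scomp (h := fun u => u - N t * T) t h
      (((hasDerivAt_id' t).sub_const (N t * T)).hasDerivWithinAt (s := Ici t))
      (fun u (hu : t ≤ u) => sub_le_sub_right hu (N t * T))
    rw [one_smul] at h2
    refine h2.congr_of_eventuallyEq_of_mem ?_ self_mem_Ici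
    filter_upwards [Ico_mem_nhdsGE hI.2] with u hu
    exact hxk (N t) u ⟨hI.1.trans hu.1, hu.2⟩
  -- At a sampling instant `N t` labels the period that begins at t, so continuity from the left
  -- must use the preceding one; hence the half-open intervals `Ioc`.
  have hleft : ∀ t, 0 < t → ∃ a < t, 0 ≤ a ∧ ContinuousWithinAt x (Icc a t) t := by
    intro t ht
    obtain ⟨k, hk⟩ : ∃ k : ℕ, t ∈ Ioc ((k : ℝ) * T) (((k : ℝ) + 1) * T) := by
      have hI := hIco t ht.le
      rcases hI.1.lt_or_eq with h | h
      · exact ⟨N t, h, hI.2.le⟩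
      · have hpos : N t ≠ 0 := by
          intro h0
          rw [h0] at h
          simp at h
          exact ht.ne h
        obtain ⟨k, hk⟩ := Nat.exists_eq_succ_of_ne_zero hpos
        refine ⟨k, ?_, ?_⟩
        · rw [← h, hk]; push_cast; nlinarith
        · rw [← h, hk]; push_cast; exact le_rfl
    refine ⟨k * T, hk.1, by positivity, ?_⟩
    have hc : ContinuousOn (fun u => ψ (s k).2 (s k).1 (u - k * T)) (Icc (k * T) t) :=
      (hsol k).continuousOn.comp (by fun_prop) (fun u hu => sub_nonneg.2 hu.1)
    refine (hc t ⟨hk.1.le, le_rfl⟩).congr (fun u hu => ?_) ?_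
    · exact hxIcc k u ⟨hu.1, hu.2.trans hk.2⟩
    · exact hxIcc k t ⟨hk.1.le, hk.2⟩
  refine ⟨x, z, ?_, ?_, ⟨?_, ?_, hderiv⟩, fun t ht => (hs _).2, ?_, ?_⟩
  · simpa [s] using hxs 0
  · simpa [s] using hzk 0 _ (hmem 0)
  · intro t ht
    rcases (mem_Ici.1 ht).eq_or_lt with rfl | h
    · exact (hderiv 0 le_rfl).continuousWithinAt
    · obtain ⟨a, hat, ha, hc⟩ := hleft t h
      refine (hc.union (hderiv t ht).continuousWithinAt).mono_of_mem_nhdsWithin ?_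
      rw [Icc_union_Ici_eq_Ici hat.le]
      exact mem_nhdsWithin_of_mem_nhds (Ici_mem_nhds hat)
  · exact fun t ht => (hsol _).mem _ (sub_nonneg.2 (hIco t ht).1)
  · intro k t ht
    rw [hzk k t ht, hzk k _ (hmem k)]
  · intro k
    have h1 := hzk (k + 1) _ (hmem (k + 1))
    have h2 := hxs (k + 1)
    rw [hs1] at h1 h2
    push_cast at h1 h2
    rw [h1, h2, hzk k _ (hmem k)]

end Existence

/-- The Lipschitz and one-sided Lipschitz bounds of the interconnection of a plant `f` with an
iteration `G` whose fixed points are given by `s`. -/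
structure InterconnectionBounds (P : WeakPairing E) (f : E → F → E) (G : E → F → F) (X : Set E)
    (Z : Set F) (s : E → F) (Lxf Lzf LxG LzG ξ ζ : ℝ) : Prop where
  Lxf_nonneg : 0 ≤ Lxf
  Lzf_pos : 0 < Lzf
  LxG_pos : 0 < LxG
  LzG_nonneg : 0 ≤ LzG
  LzG_lt : LzG < 1
  ζ_pos : 0 < ζ
  zero_mem : (0 : E) ∈ X
  s_zero : s 0 = 0
  f_zero : f 0 0 = 0
  s_mem : ∀ x ∈ X, s x ∈ Z
  s_fixed : ∀ x ∈ X, G x (s x) = s x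
  G_mem : ∀ x ∈ X, ∀ z ∈ Z, G x z ∈ Z
  f_fst : ∀ z ∈ Z, ∀ x ∈ X, ∀ y ∈ X, ‖f x z - f y z‖ ≤ Lxf * ‖x - y‖
  f_snd : ∀ x ∈ X, ∀ z ∈ Z, ∀ w ∈ Z, ‖f x z - f x w‖ ≤ Lzf * ‖z - w‖
  G_fst : ∀ z ∈ Z, ∀ x ∈ X, ∀ y ∈ X, ‖G x z - G y z‖ ≤ LxG * ‖x - y‖
  G_snd : ∀ x ∈ X, ∀ z ∈ Z, ∀ w ∈ Z, ‖G x z - G x w‖ ≤ LzG * ‖z - w‖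
  pair_plant : ∀ z ∈ Z, ∀ x ∈ X, ∀ y ∈ X, P.pair (f x z - f y z) (x - y) ≤ ξ * ‖x - y‖ ^ 2
  pair_reduced : ∀ x ∈ X, ∀ y ∈ X, P.pair (f x (s x) - f y (s y)) (x - y) ≤ -ζ * ‖x - y‖ ^ 2

/-- A bound over one sampling period of `Lip_z(f) ‖z(t) - z*(x(t))‖`, in terms of the values
`d = ‖z - z*(x)‖` and `r = ‖x‖` at the beginning of the period; `φ = ∫₀ᵀ e^{ξs} ds`. -/
noncomputable def mismatchBound (Lxf Lzf LxG LzG φ d r : ℝ) : ℝ :=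
  (1 + Lzf * LxG / (1 - LzG) * φ) * (Lzf * d) + gainC₁ Lxf Lzf LxG LzG * φ * r

/-! ### Estimates over one sampling period -/

namespace InterconnectionBounds

variable {P : WeakPairing E} {f : E → F → E} {G : E → F → F} {X : Set E} {Z : Set F} {s : E → F}
  {Lxf Lzf LxG LzG ξ ζ : ℝ}

omit [NormedSpace ℝ F]

/-- Change the arguments of G one at a time in s x = G x (s x), and absorb the term LzG ‖s x - s y‖
on the left. -/
lemma norm_s_sub_le (h : InterconnectionBounds P f G X Z s Lxf Lzf LxG LzG ξ ζ) {x y : E}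
    (hx : x ∈ X) (hy : y ∈ X) : ‖s x - s y‖ ≤ LxG / (1 - LzG) * ‖x - y‖ := by
  have hℓ := sub_pos.2 h.LzG_lt
  have h₁ : ‖s x - s y‖ ≤ LxG * ‖x - y‖ + LzG * ‖s x - s y‖ :=
    calc ‖s x - s y‖ = ‖(G x (s x) - G y (s x)) + (G y (s x) - G y (s y))‖ := by
          rw [h.s_fixed x hx, h.s_fixed y hy, sub_add_sub_cancel]
      _ ≤ _ := (norm_add_le _ _).trans (add_le_add (h.G_fst _ (h.s_mem x hx) x hx y hy)
          (h.G_snd y hy _ (h.s_mem x hx) _ (h.s_mem y hy)))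
  rw [div_mul_eq_mul_div, le_div_iff₀ hℓ]
  linarith

lemma norm_s_le (h : InterconnectionBounds P f G X Z s Lxf Lzf LxG LzG ξ ζ) {x : E}
    (hx : x ∈ X) : ‖s x‖ ≤ LxG / (1 - LzG) * ‖x‖ := by
  simpa [h.s_zero] using h.norm_s_sub_le hx h.zero_mem

lemma zero_mem_snd (h : InterconnectionBounds P f G X Z s Lxf Lzf LxG LzG ξ ζ) : (0 : F) ∈ Z :=
  h.s_zero ▸ h.s_mem 0 h.zero_mem

lemma norm_f_le (h : InterconnectionBounds P f G X Z s Lxf Lzf LxG LzG ξ ζ) {x : E} {w : F}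
    (hx : x ∈ X) (hw : w ∈ Z) :
    ‖f x w‖ ≤ Lzf * ‖w - s x‖ + (Lxf + Lzf * LxG / (1 - LzG)) * ‖x‖ := by
  have hs := h.s_mem x hx
  have h₁ := h.f_snd x hx w hw _ hs
  have h₂ := h.f_snd x hx _ hs 0 h.zero_mem_snd
  have h₃ := h.f_fst 0 h.zero_mem_snd x hx 0 h.zero_mem
  rw [h.f_zero, sub_zero, sub_zero] at h₃
  rw [sub_zero] at h₂
  have h₄ : Lzf * ‖s x‖ ≤ Lzf * LxG / (1 - LzG) * ‖x‖ := by
    rw [mul_div_assoc, mul_assoc]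
    exact mul_le_mul_of_nonneg_left (h.norm_s_le hx) h.Lzf_pos.le
  have e : f x w = (f x w - f x (s x)) + ((f x (s x) - f x 0) + f x 0) := by abel
  have h₅ := norm_add_le (f x w - f x (s x)) ((f x (s x) - f x 0) + f x 0)
  have h₆ := norm_add_le (f x (s x) - f x 0) (f x 0)
  rw [← e] at h₅
  linarith

lemma norm_iterate_sub_le (h : InterconnectionBounds P f G X Z s Lxf Lzf LxG LzG ξ ζ) {x : E}
    {w : F} (hx : x ∈ X) (hw : w ∈ Z) (n : ℕ) :
    (G x)^[n] w ∈ Z ∧ ‖(G x)^[n] w - s x‖ ≤ LzG ^ n * ‖w - s x‖ := by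
  induction n with
  | zero => simpa using hw
  | succ n ih =>
    rw [Function.iterate_succ_apply']
    refine ⟨h.G_mem x hx _ ih.1, ?_⟩
    have h₁ := h.G_snd x hx _ ih.1 _ (h.s_mem x hx)
    rw [h.s_fixed x hx] at h₁
    calc _ ≤ _ := h₁
      _ ≤ LzG * (LzG ^ n * ‖w - s x‖) := mul_le_mul_of_nonneg_left ih.2 h.LzG_nonneg
      _ = _ := by ring

variable {x : ℝ → E} {w : F} {a T : ℝ}

/-- The plant is driven by the constant input `w` over one sampling period `[a, a + T]`. -/
structure _root_.HeldTrajectory (f : E → F → E) (X : Set E) (Z : Set F) (x : ℝ → E) (w : F)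
    (a T : ℝ) : Prop where
  continuousOn : ContinuousOn x (Icc a (a + T))
  mem : ∀ t ∈ Icc a (a + T), x t ∈ X
  input_mem : w ∈ Z
  deriv : ∀ t ∈ Ico a (a + T), HasDerivWithinAt x (f (x t) w) (Ici t) t

lemma _root_.HeldTrajectory.continuousWithinAt (hx : HeldTrajectory f X Z x w a T)
    (hf : ContinuousOn (Function.uncurry f) (X ×ˢ Z)) {t : ℝ} (ht : t ∈ Ico a (a + T)) :
    ContinuousWithinAt (fun t => f (x t) w) (Ioi t) t := by
  have h₁ : ContinuousOn (fun t => f (x t) w) (Icc a (a + T)) :=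
    hf.comp (f := fun t => (x t, w)) (hx.continuousOn.prodMk continuousOn_const)
      (fun t ht => ⟨hx.mem t ht, hx.input_mem⟩)
  refine (h₁ t (Ico_subset_Icc_self ht)).mono_of_mem_nhdsWithin ?_
  filter_upwards [Ioo_mem_nhdsGT ht.2] with u hu using ⟨ht.1.trans hu.1.le, hu.2.le⟩

/-- The displacement x(t) - x(a) starts at 0, grows at one-sided rate ξ and is forced by the
constant vector f(x(a), w). -/
lemma norm_state_sub_le (h : InterconnectionBounds P f G X Z s Lxf Lzf LxG LzG ξ ζ)
    (hP : P.Compatible) (hf : ContinuousOn (Function.uncurry f) (X ×ˢ Z))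
    (hx : HeldTrajectory f X Z x w a T) {t : ℝ} (ht : t ∈ Icc a (a + T)) :
    ‖x t - x a‖ ≤ (Lzf * ‖w - s (x a)‖ + (Lxf + Lzf * LxG / (1 - LzG)) * ‖x a‖) *
      gronwallBound 0 ξ 1 T := by
  have ha : a ∈ Icc a (a + T) := ⟨le_rfl, ht.1.trans ht.2⟩
  have hxa := hx.mem a ha
  have hb := hP.norm_le_gronwallBound (g := fun t => x t - x a) (y := fun t => f (x t) w)
    (ξ := ξ) (c := ‖f (x a) w‖) (norm_nonneg _) (hx.continuousOn.sub continuousOn_const)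
    (fun t ht => (hx.deriv t ht).sub_const _) (fun t ht => hx.continuousWithinAt hf ht)
    (fun t ht => ?_) ht
  · rw [sub_self, norm_zero, gronwallBound_zero_mul] at hb
    refine hb.trans (mul_le_mul (h.norm_f_le hxa hx.input_mem)
      ((gronwallBound_zero_one_strictMono ξ).monotone (by linarith [ht.2])) ?_
      ((norm_nonneg _).trans (h.norm_f_le hxa hx.input_mem)))
    simpa [gronwallBound_x0] using
      (gronwallBound_zero_one_strictMono ξ).monotone (sub_nonneg.2 ht.1)
  · have h₁ := P.pair_add_le (f (x t) w - f (x a) w) (f (x a) w) (x t - x a)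
    rw [sub_add_cancel] at h₁
    linarith [h.pair_plant w hx.input_mem _ (hx.mem t (Ico_subset_Icc_self ht)) _ hxa,
      hP.pair_le (f (x a) w) (x t - x a)]

/-- The input is constant, so the mismatch changes only through s(x(t)), by at most LxG / (1 - LzG)
times the displacement. -/
lemma mismatch_le (h : InterconnectionBounds P f G X Z s Lxf Lzf LxG LzG ξ ζ)
    (hP : P.Compatible) (hf : ContinuousOn (Function.uncurry f) (X ×ˢ Z))
    (hx : HeldTrajectory f X Z x w a T) {t : ℝ} (ht : t ∈ Icc a (a + T)) :
    Lzf * ‖w - s (x t)‖ ≤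
      mismatchBound Lxf Lzf LxG LzG (gronwallBound 0 ξ 1 T) ‖w - s (x a)‖ ‖x a‖ := by
  have ha : a ∈ Icc a (a + T) := ⟨le_rfl, ht.1.trans ht.2⟩
  have hxa := hx.mem a ha
  have hσ : 0 ≤ LxG / (1 - LzG) := div_nonneg h.LxG_pos.le (sub_pos.2 h.LzG_lt).le
  have h₁ : ‖w - s (x t)‖ ≤ ‖w - s (x a)‖ + ‖s (x t) - s (x a)‖ := by
    rw [norm_sub_rev (s (x t))]
    exact norm_sub_le_norm_sub_add_norm_sub _ _ _
  have h₂ := (h.norm_s_sub_le (hx.mem t ht) hxa).trans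
    (mul_le_mul_of_nonneg_left (h.norm_state_sub_le hP hf hx ht) hσ)
  have h₃ := mul_le_mul_of_nonneg_left (h₁.trans (add_le_add le_rfl h₂)) h.Lzf_pos.le
  refine h₃.trans (le_of_eq ?_)
  unfold mismatchBound gainC₁
  ring

/-- Compare with the equilibrium 0 of the reduced model: contraction at rate ζ, with a perturbation
of size at most V. -/
lemma norm_le_of_held (h : InterconnectionBounds P f G X Z s Lxf Lzf LxG LzG ξ ζ)
    (hP : P.Compatible) (hf : ContinuousOn (Function.uncurry f) (X ×ˢ Z))
    (hx : HeldTrajectory f X Z x w a T) {t : ℝ} (ht : t ∈ Icc a (a + T)) {V : ℝ} (hV0 : 0 ≤ V)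
    (hV : mismatchBound Lxf Lzf LxG LzG (gronwallBound 0 ξ 1 T) ‖w - s (x a)‖ ‖x a‖ ≤ V) :
    ‖x t‖ ≤ ‖x a‖ * Real.exp (-ζ * (t - a)) + V / ζ * (1 - Real.exp (-ζ * (t - a))) := by
  have hb := hP.norm_le_gronwallBound (g := x) (y := fun t => f (x t) w)
    (ξ := -ζ) (c := V) hV0 hx.continuousOn
    (fun t ht => hx.deriv t ht) (fun t ht => hx.continuousWithinAt hf ht)
    (fun t ht => ?_) ht
  · rw [gronwallBound_of_K_ne_0 (neg_ne_zero.2 h.ζ_pos.ne')] at hb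
    refine hb.trans (le_of_eq ?_)
    rw [div_neg]
    ring
  · have ht' := Ico_subset_Icc_self ht
    have hxt := hx.mem t ht'
    have h₁ := P.pair_add_le (f (x t) w - f (x t) (s (x t))) (f (x t) (s (x t))) (x t)
    rw [sub_add_cancel] at h₁
    have h₂ := h.pair_reduced _ hxt 0 h.zero_mem
    rw [h.s_zero, h.f_zero, sub_zero, sub_zero] at h₂
    have h₃ := (hP.pair_le (f (x t) w - f (x t) (s (x t))) (x t)).trans
      (mul_le_mul_of_nonneg_right ((h.f_snd _ hxt w hx.input_mem _ (h.s_mem _ hxt)).trans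
        ((h.mismatch_le hP hf hx ht').trans hV)) (norm_nonneg _))
    linarith

/-! ### Small-gain condition and exponential decay -/

lemma interconnection_gain_pos (h : InterconnectionBounds P f G X Z s Lxf Lzf LxG LzG ξ ζ) :
    0 < Lzf * LxG / (1 - LzG) :=
  div_pos (mul_pos h.Lzf_pos h.LxG_pos) (sub_pos.2 h.LzG_lt)

lemma gainC₁_pos (h : InterconnectionBounds P f G X Z s Lxf Lzf LxG LzG ξ ζ) :
    0 < gainC₁ Lxf Lzf LxG LzG := by
  have := h.interconnection_gain_pos
  have := h.Lxf_nonneg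
  unfold gainC₁
  positivity

lemma gainC₂_nonneg (h : InterconnectionBounds P f G X Z s Lxf Lzf LxG LzG ξ ζ) (n : ℕ) :
    0 ≤ gainC₂ Lzf LxG LzG n := by
  have h₁ := h.interconnection_gain_pos
  unfold gainC₂
  rw [mul_comm LxG Lzf]
  exact mul_nonneg (pow_nonneg h.LzG_nonneg n) h₁.le

lemma threshold_bound_pos (h : InterconnectionBounds P f G X Z s Lxf Lzf LxG LzG ξ ζ) {n : ℕ}
    (hn : 1 ≤ n) :
    0 < (1 - LzG ^ n) / (gainC₂ Lzf LxG LzG n + gainC₁ Lxf Lzf LxG LzG / ζ) :=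
  div_pos (sub_pos.2 (pow_lt_one₀ h.LzG_nonneg h.LzG_lt (by omega)))
    (add_pos_of_nonneg_of_pos (h.gainC₂_nonneg n) (div_pos h.gainC₁_pos h.ζ_pos))

/-- The linear comparison system of the pair (state, mismatch bound) decays geometrically in a
weighted maximum norm. -/
lemma exists_weights (h : InterconnectionBounds P f G X Z s Lxf Lzf LxG LzG ξ ζ) {n : ℕ}
    {T : ℝ} (hT : 0 < T)
    (hq : gronwallBound 0 ξ 1 T <
      (1 - LzG ^ n) / (gainC₂ Lzf LxG LzG n + gainC₁ Lxf Lzf LxG LzG / ζ)) :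
    ∃ p ρ : ℝ, 0 < p ∧ 0 < ρ ∧ ρ < 1 ∧
      p * Real.exp (-ζ * T) + 1 / ζ * (1 - Real.exp (-ζ * T)) ≤ p * ρ ∧
      (1 + Lzf * LxG / (1 - LzG) * gronwallBound 0 ξ 1 T) * LzG ^ n +
        gainC₁ Lxf Lzf LxG LzG * gronwallBound 0 ξ 1 T * p ≤ ρ := by
  set φ := gronwallBound 0 ξ 1 T
  have hφ : 0 < φ := gronwallBound_zero_one_pos ξ hT
  have hζ := h.ζ_pos
  set A := (1 + Lzf * LxG / (1 - LzG) * φ) * LzG ^ n with hA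
  set B := gainC₁ Lxf Lzf LxG LzG * φ with hB
  have hBpos : 0 < B := mul_pos h.gainC₁_pos hφ
  have hsum : A + B / ζ < 1 := by
    rw [lt_div_iff₀ (add_pos_of_nonneg_of_pos (h.gainC₂_nonneg n)
      (div_pos h.gainC₁_pos h.ζ_pos))] at hq
    have e : A + B / ζ =
        LzG ^ n + φ * (gainC₂ Lzf LxG LzG n + gainC₁ Lxf Lzf LxG LzG / ζ) := by
      rw [hA, hB, gainC₂]; ring
    linarith
  -- The lower bound makes the state inequality contract (a weighted mean of p and 1/ζ lies below
  -- p), the upper one the mismatch inequality; A + B/ζ < 1 leaves room between them.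
  obtain ⟨p, hp₁, hp₂⟩ : ∃ p, 1 / ζ < p ∧ p < (1 - A) / B := by
    refine exists_between ?_
    rw [lt_div_iff₀ hBpos, one_div_mul_eq_div]
    linarith
  have hp : 0 < p := (one_div_pos.2 hζ).trans hp₁
  rw [lt_div_iff₀ hBpos] at hp₂
  have hexp : Real.exp (-ζ * T) < 1 := Real.exp_lt_one_iff.2 (by nlinarith)
  have h₁ : p * Real.exp (-ζ * T) + 1 / ζ * (1 - Real.exp (-ζ * T)) < p := by nlinarith
  obtain ⟨ρ, hρ₁, hρ₂⟩ := exists_between (a₁ := max (max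
      ((p * Real.exp (-ζ * T) + 1 / ζ * (1 - Real.exp (-ζ * T))) / p) (A + B * p)) 0) (a₂ := 1)
    (max_lt (max_lt ((div_lt_one hp).2 h₁) (by linarith)) one_pos)
  obtain ⟨hρ₁, hρ₀⟩ := max_lt_iff.1 hρ₁
  obtain ⟨hρ₃, hρ₄⟩ := max_lt_iff.1 hρ₁
  refine ⟨p, ρ, hp, hρ₀, hρ₂, ?_, hρ₄.le⟩
  rw [div_lt_iff₀ hp] at hρ₃
  linarith

lemma mismatchBound_nonneg (h : InterconnectionBounds P f G X Z s Lxf Lzf LxG LzG ξ ζ)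
    {φ d r : ℝ} (hφ : 0 ≤ φ) (hd : 0 ≤ d) (hr : 0 ≤ r) :
    0 ≤ mismatchBound Lxf Lzf LxG LzG φ d r := by
  have := h.interconnection_gain_pos
  have := h.gainC₁_pos
  have := h.Lzf_pos
  unfold mismatchBound
  positivity

lemma mul_le_mismatchBound (h : InterconnectionBounds P f G X Z s Lxf Lzf LxG LzG ξ ζ)
    {φ d r : ℝ} (hφ : 0 ≤ φ) (hd : 0 ≤ d) (hr : 0 ≤ r) :
    Lzf * d ≤ mismatchBound Lxf Lzf LxG LzG φ d r := by
  have := h.interconnection_gain_pos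
  have := h.gainC₁_pos
  have := h.Lzf_pos
  unfold mismatchBound
  have h₁ : 0 ≤ Lzf * LxG / (1 - LzG) * φ * (Lzf * d) + gainC₁ Lxf Lzf LxG LzG * φ * r := by
    positivity
  linarith

omit [NormedAddCommGroup F] in
lemma _root_.IsSolution.heldTrajectory {n : ℕ} {x : ℝ → E} {z : ℝ → F} (hT : 0 < T)
    (hs : IsSolution f G X Z n T x z) (k : ℕ) :
    HeldTrajectory f X Z x (z (k * T)) (k * T) T := by
  have hk : 0 ≤ (k : ℝ) * T := by positivity
  refine ⟨hs.plant.continuousOn.mono fun t ht => hk.trans ht.1,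
    fun t ht => hs.plant.mem t (hk.trans ht.1), hs.mem _ hk, fun t ht => ?_⟩
  rw [← hs.hold k t ⟨ht.1, by linarith [ht.2]⟩]
  exact hs.plant.deriv t (hk.trans ht.1)

/-- The state and the mismatch bound decay geometrically at the sampling instants. -/
lemma geometric_decay (h : InterconnectionBounds P f G X Z s Lxf Lzf LxG LzG ξ ζ)
    (hP : P.Compatible) (hf : ContinuousOn (Function.uncurry f) (X ×ˢ Z)) {n : ℕ} (hT : 0 < T)
    {z : ℝ → F} (hs : IsSolution f G X Z n T x z) {p ρ c : ℝ}
    (h₁ : p * Real.exp (-ζ * T) + 1 / ζ * (1 - Real.exp (-ζ * T)) ≤ p * ρ)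
    (h₂ : (1 + Lzf * LxG / (1 - LzG) * gronwallBound 0 ξ 1 T) * LzG ^ n +
        gainC₁ Lxf Lzf LxG LzG * gronwallBound 0 ξ 1 T * p ≤ ρ)
    (hp : 0 < p) (hρ₀ : 0 < ρ) (hρ₁ : ρ < 1) (hc : 0 ≤ c) (hx₀ : ‖x 0‖ ≤ c * p)
    (hV₀ : mismatchBound Lxf Lzf LxG LzG (gronwallBound 0 ξ 1 T) ‖z 0 - s (x 0)‖ ‖x 0‖ ≤ c)
    (k : ℕ) :
    ‖x (k * T)‖ ≤ c * ρ ^ k * p ∧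
      mismatchBound Lxf Lzf LxG LzG (gronwallBound 0 ξ 1 T)
        ‖z (k * T) - s (x (k * T))‖ ‖x (k * T)‖ ≤ c * ρ ^ k := by
  have hφ := gronwallBound_zero_one_pos ξ hT
  have hκ := h.interconnection_gain_pos
  have hC₁ := h.gainC₁_pos
  induction k with
  | zero => simpa using ⟨hx₀, hV₀⟩
  | succ k ih =>
    obtain ⟨ihx, ihV⟩ := ih
    have hk : 0 ≤ (k : ℝ) * T := by positivity
    have hheld := hs.heldTrajectory hT k
    have hmem : ((k : ℝ) + 1) * T ∈ Icc ((k : ℝ) * T) (k * T + T) := ⟨by linarith, by linarith⟩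
    have hcρ : 0 ≤ c * ρ ^ k := by positivity
    have hexp : Real.exp (-ζ * T) ≤ 1 := Real.exp_le_one_iff.2 (by nlinarith [h.ζ_pos])
    have hx := h.norm_le_of_held hP hf hheld hmem hcρ ihV
    rw [show ((k : ℝ) + 1) * T - k * T = T by ring] at hx
    have hx' : ‖x (((k : ℝ) + 1) * T)‖ ≤ c * ρ ^ (k + 1) * p :=
      calc _ ≤ _ := hx
        _ ≤ c * ρ ^ k * p * Real.exp (-ζ * T) + c * ρ ^ k / ζ * (1 - Real.exp (-ζ * T)) := by
            gcongr
        _ = c * ρ ^ k * (p * Real.exp (-ζ * T) + 1 / ζ * (1 - Real.exp (-ζ * T))) := by ring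
        _ ≤ c * ρ ^ k * (p * ρ) := by gcongr
        _ = _ := by ring
    have hm := (h.mismatch_le hP hf hheld hmem).trans ihV
    have hit := (h.norm_iterate_sub_le (hheld.mem _ hmem) hheld.input_mem n).2
    rw [← hs.update k] at hit
    push_cast
    refine ⟨hx', ?_⟩
    have hd : Lzf * ‖z (((k : ℝ) + 1) * T) - s (x (((k : ℝ) + 1) * T))‖ ≤
        LzG ^ n * (c * ρ ^ k) :=
      calc _ ≤ Lzf * (LzG ^ n * ‖z (k * T) - s (x (((k : ℝ) + 1) * T))‖) :=
            mul_le_mul_of_nonneg_left hit h.Lzf_pos.le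
        _ = LzG ^ n * (Lzf * ‖z (k * T) - s (x (((k : ℝ) + 1) * T))‖) := by ring
        _ ≤ _ := mul_le_mul_of_nonneg_left hm (pow_nonneg h.LzG_nonneg n)
    -- V_{k+1} involves ‖x_{k+1}‖, but `h₂` has no factor ρ on its last term, so the weaker bound c
    -- ρᵏ p suffices.
    have hρk : c * ρ ^ (k + 1) ≤ c * ρ ^ k := by
      rw [pow_succ, ← mul_assoc]
      exact mul_le_of_le_one_right hcρ hρ₁.le
    unfold mismatchBound
    calc _ ≤ (1 + Lzf * LxG / (1 - LzG) * gronwallBound 0 ξ 1 T) * (LzG ^ n * (c * ρ ^ k)) +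
          gainC₁ Lxf Lzf LxG LzG * gronwallBound 0 ξ 1 T * (c * ρ ^ k * p) := by
          gcongr
          exact hx'.trans (mul_le_mul_of_nonneg_right hρk hp.le)
      _ = c * ρ ^ k * ((1 + Lzf * LxG / (1 - LzG) * gronwallBound 0 ξ 1 T) * LzG ^ n +
          gainC₁ Lxf Lzf LxG LzG * gronwallBound 0 ξ 1 T * p) := by ring
      _ ≤ c * ρ ^ k * ρ := mul_le_mul_of_nonneg_left h₂ hcρ
      _ = _ := by ring

/-- All solutions decay exponentially in the product norm, at a rate and with a factor that do
not depend on the solution. -/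
lemma exponential_decay (h : InterconnectionBounds P f G X Z s Lxf Lzf LxG LzG ξ ζ)
    (hP : P.Compatible) (hf : ContinuousOn (Function.uncurry f) (X ×ˢ Z)) {n : ℕ} (hT : 0 < T)
    (hq : gronwallBound 0 ξ 1 T <
      (1 - LzG ^ n) / (gainC₂ Lzf LxG LzG n + gainC₁ Lxf Lzf LxG LzG / ζ)) :
    ∃ a : ℝ, 0 < a ∧ ∃ r : ℝ, 0 ≤ r ∧ ∀ (x : ℝ → E) (z : ℝ → F), IsSolution f G X Z n T x z →
      ∀ t, 0 ≤ t → ‖(x t, z t)‖ ≤ r * Real.exp (-a * t) * ‖(x 0, z 0)‖ := by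
  obtain ⟨p, ρ, hp, hρ₀, hρ₁, h₁, h₂⟩ := h.exists_weights hT hq
  have hφ := gronwallBound_zero_one_pos ξ hT
  have hκ := h.interconnection_gain_pos
  have hC₁ := h.gainC₁_pos
  have hLzf := h.Lzf_pos
  have hζ := h.ζ_pos
  set σ := LxG / (1 - LzG) with hσ_def
  have hσ : 0 < σ := div_pos h.LxG_pos (sub_pos.2 h.LzG_lt)
  -- K₀ bounds the weighted maximum norm of the initial pair (state, mismatch bound) by the initial
  -- norm; K₁ below converts back, at all times of a period.
  set K₀ := 1 / p + mismatchBound Lxf Lzf LxG LzG (gronwallBound 0 ξ 1 T) (1 + σ) 1 with hK₀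
  have hmb : 0 ≤ mismatchBound Lxf Lzf LxG LzG (gronwallBound 0 ξ 1 T) (1 + σ) 1 :=
    h.mismatchBound_nonneg hφ.le (by positivity) zero_le_one
  have hK₀0 : 0 ≤ K₀ := by positivity
  set K₁ := (p + 1 / ζ) + (1 / Lzf + σ * p) with hK₁
  have hK₁0 : 0 ≤ K₁ := by positivity
  have hlog : Real.log ρ < 0 := Real.log_neg hρ₀ hρ₁
  refine ⟨-Real.log ρ / T, div_pos (neg_pos.2 hlog) hT, K₁ * K₀ / ρ, by positivity, ?_⟩
  intro x z hs t ht
  set M := ‖(x 0, z 0)‖ with hM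
  have hx0 : ‖x 0‖ ≤ M := norm_fst_le (x 0, z 0)
  have hz0 : ‖z 0‖ ≤ M := norm_snd_le (x 0, z 0)
  have hM0 : 0 ≤ M := norm_nonneg _
  have hxX := hs.plant.mem 0 le_rfl
  have hd0 : ‖z 0 - s (x 0)‖ ≤ (1 + σ) * M := by
    have h₃ := h.norm_s_le hxX
    have h₄ := mul_le_mul_of_nonneg_left hx0 hσ.le
    linarith [_root_.norm_sub_le (z 0) (s (x 0))]
  have hdec := h.geometric_decay hP hf hT hs (c := K₀ * M) h₁ h₂ hp hρ₀ hρ₁ (by positivity)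
    (by
      have : 1 / p * M * p ≤ K₀ * M * p := by gcongr; linarith
      have e : 1 / p * M * p = M := by field_simp
      linarith)
    (by
      calc _ ≤ mismatchBound Lxf Lzf LxG LzG (gronwallBound 0 ξ 1 T) ((1 + σ) * M) M := by
            unfold mismatchBound; gcongr
        _ = mismatchBound Lxf Lzf LxG LzG (gronwallBound 0 ξ 1 T) (1 + σ) 1 * M := by
            unfold mismatchBound; ring
        _ ≤ K₀ * M := by
            gcongr
            rw [hK₀]
            exact le_add_of_nonneg_left (by positivity))
  set k := ⌊t / T⌋₊ with hk
  obtain ⟨hxk, hVk⟩ := hdec k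
  have hk₁ : (k : ℝ) * T ≤ t := (le_div_iff₀ hT).1 (Nat.floor_le (by positivity))
  have hk₂ : t < ((k : ℝ) + 1) * T := (div_lt_iff₀ hT).1 (Nat.lt_floor_add_one _)
  set c := K₀ * M * ρ ^ k with hc
  have hc0 : 0 ≤ c := by positivity
  have hheld := hs.heldTrajectory hT k
  have htmem : t ∈ Icc ((k : ℝ) * T) (k * T + T) := ⟨hk₁, by linarith⟩
  have hxt : ‖x t‖ ≤ c * (p + 1 / ζ) := by
    have h₃ := h.norm_le_of_held hP hf hheld htmem hc0 hVk
    have he : Real.exp (-ζ * (t - k * T)) ≤ 1 :=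
      Real.exp_le_one_iff.2 (by nlinarith [sub_nonneg.2 hk₁])
    have he0 := Real.exp_pos (-ζ * (t - k * T))
    calc ‖x t‖ ≤ _ := h₃
      _ ≤ c * p * 1 + c / ζ * 1 := by
          gcongr
          linarith
      _ = _ := by ring
  have hzt : ‖z t‖ ≤ c * (1 / Lzf + σ * p) := by
    rw [hs.hold k t ⟨hk₁, hk₂⟩]
    have h₃ := (h.mul_le_mismatchBound hφ.le (norm_nonneg _) (norm_nonneg _)).trans hVk
    have h₄ : ‖z (k * T) - s (x (k * T))‖ ≤ c / Lzf := by
      rw [le_div_iff₀ hLzf]; linarith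
    have h₅ := (h.norm_s_le (hheld.mem _ ⟨le_rfl, by linarith⟩)).trans
      (mul_le_mul_of_nonneg_left hxk hσ.le)
    have h₆ := norm_sub_norm_le (z (k * T)) (s (x (k * T)))
    calc _ ≤ c / Lzf + σ * (c * p) := by linarith
      _ = _ := by ring
  -- Only k + 1 > t/T is known for the integer part k; the missing step costs the factor 1/ρ.
  have hρk : ρ ^ k ≤ Real.exp (-(-Real.log ρ / T) * t) / ρ := by
    rw [le_div_iff₀ hρ₀, ← pow_succ, ← Real.exp_log (pow_pos hρ₀ (k + 1)), Real.log_pow]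
    refine Real.exp_le_exp.2 ?_
    push_cast
    have h₃ : t / T ≤ (k : ℝ) + 1 := (div_le_iff₀ hT).2 hk₂.le
    have h₄ := mul_le_mul_of_nonpos_right h₃ hlog.le
    calc _ ≤ _ := h₄
      _ = _ := by ring
  calc ‖(x t, z t)‖ ≤ ‖x t‖ + ‖z t‖ := by
        rw [Prod.norm_mk]
        exact max_le (le_add_of_nonneg_right (norm_nonneg _))
          (le_add_of_nonneg_left (norm_nonneg _))
    _ ≤ K₀ * M * ρ ^ k * K₁ := by rw [hK₁, mul_add]; exact add_le_add hxt hzt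
    _ ≤ K₀ * M * (Real.exp (-(-Real.log ρ / T) * t) / ρ) * K₁ := by gcongr
    _ = _ := by ring

end InterconnectionBounds

end Auxiliary

/-! ### Assembly -/

theorem theorem3 {E F : Type*}
    [NormedAddCommGroup E] [NormedSpace ℝ E] [FiniteDimensional ℝ E]
    [NormedAddCommGroup F] [NormedSpace ℝ F] [FiniteDimensional ℝ F]
    (P : WeakPairing E) (hP : P.Compatible)
    (X : Set E) (Z : Set F) (hX : Convex ℝ X) (hZ : Convex ℝ Z) (hZc : IsClosed Z)
    (hX0 : (0 : E) ∈ X) (hZ0 : (0 : F) ∈ Z)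
    (f : E → F → E) (G : E → F → F)
    (hf : ContinuousOn (Function.uncurry f) (X ×ˢ Z))
    (hG : ContinuousOn (Function.uncurry G) (X ×ˢ Z))
    (hinv : ForwardInvariant f G X Z)
    (hf0 : f 0 0 = 0) (hG0 : G 0 0 = 0)
    -- the plant is Lipschitz in its state
    (hLxf : lipFst X Z f < ⊤)
    -- Lipschitz interconnection
    (hLzf_pos : 0 < lipSnd X Z f) (hLzf : lipSnd X Z f < ⊤)
    (hLxG_pos : 0 < lipFst X Z G) (hLxG : lipFst X Z G < ⊤)
    -- contractive discrete-time dynamics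
    (hLzG : lipSnd X Z G < 1)
    (ξ ζ : ℝ) (hξ : osLipFst P X Z f ≤ (ξ : EReal)) (hζ : 0 < ζ)
    -- the reduced model is strongly infinitesimally contracting
    (hRM : osLip P X (fun x => f x (zStar Z G x)) ≤ ((-ζ : ℝ) : EReal)) :
    ∀ n : ℕ, 1 ≤ n →
      0 < samplingThreshold ξ ζ (lipFst X Z f).toReal (lipSnd X Z f).toReal
        (lipFst X Z G).toReal (lipSnd X Z G).toReal n ∧
      ∀ T : ℝ, 0 < T →
        (T : EReal) < samplingThreshold ξ ζ (lipFst X Z f).toReal (lipSnd X Z f).toReal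
          (lipFst X Z G).toReal (lipSnd X Z G).toReal n →
        RendersOriginGES f G X Z n T := by
  have hLzG_fin : lipSnd X Z G < ⊤ := hLzG.trans ENNReal.one_lt_top
  have hLzG_lt : (lipSnd X Z G).toReal < 1 := by
    rw [← ENNReal.toReal_one]
    exact (ENNReal.toReal_lt_toReal hLzG_fin.ne ENNReal.one_ne_top).2 hLzG
  have hstar : ∀ x ∈ X, zStar Z G x ∈ Z ∧ G x (zStar Z G x) = zStar Z G x := fun x hx =>
    zStar_spec hZc ⟨0, hZ0⟩ hLzG hx (hinv.update x hx)
  -- Both 0 and the chosen point are fixed by the contraction G(0, ·), hence equal.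
  have hstar0 : zStar Z G 0 = 0 := by
    have h₁ := norm_sub_le_lipSnd hLzG_fin hX0 (hstar 0 hX0).1 hZ0
    rw [(hstar 0 hX0).2, hG0, sub_zero] at h₁
    exact norm_le_zero_iff.1 (by nlinarith [norm_nonneg (zStar Z G 0)])
  have h : InterconnectionBounds P f G X Z (zStar Z G) (lipFst X Z f).toReal
      (lipSnd X Z f).toReal (lipFst X Z G).toReal (lipSnd X Z G).toReal ξ ζ :=
    { Lxf_nonneg := ENNReal.toReal_nonneg
      Lzf_pos := ENNReal.toReal_pos hLzf_pos.ne' hLzf.ne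
      LxG_pos := ENNReal.toReal_pos hLxG_pos.ne' hLxG.ne
      LzG_nonneg := ENNReal.toReal_nonneg
      LzG_lt := hLzG_lt
      ζ_pos := hζ
      zero_mem := hX0
      s_zero := hstar0
      f_zero := hf0
      s_mem := fun x hx => (hstar x hx).1
      s_fixed := fun x hx => (hstar x hx).2
      G_mem := hinv.update
      f_fst := fun z hz x hx y hy => norm_sub_le_lipFst hLxf hz hx hy
      f_snd := fun x hx z hz w hw => norm_sub_le_lipSnd hLzf hx hz hw
      G_fst := fun z hz x hx y hy => norm_sub_le_lipFst hLxG hz hx hy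
      G_snd := fun x hx z hz w hw => norm_sub_le_lipSnd hLzG_fin hx hz hw
      pair_plant := fun z hz x hx y hy =>
        hP.pair_le_of_osLip_le (φ := fun x => f x z)
          ((le_iSup₂ (f := fun z (_ : z ∈ Z) => osLip P X fun x => f x z) z hz).trans hξ) hx hy
      pair_reduced := fun x hx y hy => hP.pair_le_of_osLip_le hRM hx hy }
  intro n hn
  have hq := h.threshold_bound_pos hn
  refine ⟨samplingThreshold_pos hq, fun T hT hTn =>
    ⟨fun x₀ hx₀ z₀ hz₀ => exists_isSolution hinv n hT hx₀ hz₀, fun N hN => ?_⟩⟩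
  obtain ⟨a, ha, r, hr, hdecay⟩ := h.exponential_decay hP hf (n := n) hT
    (gronwallBound_lt_of_lt_samplingThreshold hq hTn)
  obtain ⟨c, C, hc, hC, hcC⟩ := N.exists_norm_equiv hN
  refine ⟨a, ha, C * r * c, by positivity, fun x z hs t ht => ?_⟩
  calc N (x t, z t) ≤ C * ‖(x t, z t)‖ := (hcC _).1
    _ ≤ C * (r * Real.exp (-a * t) * ‖(x 0, z 0)‖) := by
        gcongr
        exact hdecay x z hs t ht
    _ ≤ C * (r * Real.exp (-a * t) * (c * N (x 0, z 0))) := by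
        gcongr
        exact (hcC _).2
    _ = _ := by ring
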